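/- Let $\rho\in(0,1)$ and let $P_{XY}$ be the doubly symmetric binary source on $\{0,1\}^2$ with correlation $\rho$, that is, $P_{XY}(0,0)=P_{XY}(1,1)=\frac{1+\rho}{4}$ and $P_{XY}(0,1)=P_{XY}(1,0)=\frac{1-\rho}{4}$. All logarithms are to base $2$ and $D(Q\|P)$ denotes relative entropy. For $a,b\in[0,1]$ put $$\mathbb{D}_2(a,b)=\min_{\max\{0,a+b-1\}\le p\le\min\{a,b\}} D\left(\begin{bmatrix}1+p-a-b & b-p\\ a-p & p\end{bmatrix}\Big\|P_{XY}\right),$$ the least relative entropy to $P_{XY}$ of a joint law on $\{0,1\}^2$ with $Q(X=1)=a$ and $Q(Y=1)=b$. Let $H_2(t)=-t\log t-(1-t)\log(1-t)$, let $H_2^{-1}:[0,1]\to[0,\frac12]$ be the inverse of the restriction of $H_2$ to $[0,\frac12]$, and put $D_2^{-1}(s)=H_2^{-1}(1-s)$. For $s,t\in[0,1]$ let $$\varphi(s,t)=\mathbb{D}_2\left(D_2^{-1}(s),D_2^{-1}(t)\right)$$ be the lower envelope of the minimum-relative-entropy region, and for $\alpha,\beta\in[0,1]$ let $$\widetilde\varphi(\alpha,\beta)=\min_{\alpha\le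 s\le1,\ \beta\le t\le1}\varphi(s,t)$$ be its lower increasing envelope. **Theorem.** For every $\rho\in(0,1)$ the minimum defining $\widetilde\varphi(\alpha,\beta)$ is attained for all $\alpha,\beta\in[0,1]$, and the function $\widetilde\varphi$ is convex on $[0,1]^2$. Consequently $\underline\Theta=\widetilde\varphi$ on $[0,1]^2$, where $\underline\Theta$ is the lower convex envelope of $\widetilde\varphi$, that is, the pointwise supremum of all convex functions on $[0,1]^2$ that are at most $\widetilde\varphi$. -/

import Mathlib

open Set

noncomputable section

namespace DSBS

/-- Relative entropy `D(Q‖P)` in bits of two probability mass functions on a finite alphabet,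
with `0 log 0 = 0`; it is used only for `P` of full support, so that it is finite. -/
def relEntropy {ι : Type*} [Fintype ι] (Q P : ι → ℝ) : ℝ :=
  ∑ i, Q i * Real.logb 2 (Q i / P i)

/-- The doubly symmetric binary source `P_XY` with correlation `ρ`. -/
def pXY (ρ : ℝ) (z : Fin 2 × Fin 2) : ℝ :=
  !![(1 + ρ) / 4, (1 - ρ) / 4; (1 - ρ) / 4, (1 + ρ) / 4] z.1 z.2

/-- The joint law on `{0,1}²` with `Q(X = 1) = a`, `Q(Y = 1) = b` and `Q(X = 1, Y = 1) = p`. -/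
def coupling (a b p : ℝ) (z : Fin 2 × Fin 2) : ℝ :=
  !![1 + p - a - b, b - p; a - p, p] z.1 z.2

/-- `D₂^{(a,b)}(p)`. -/
def couplingDiv (ρ a b p : ℝ) : ℝ :=
  relEntropy (coupling a b p) (pXY ρ)

/-- `𝔻₂(a,b)`, the least relative entropy to `P_XY` of a joint law whose marginals are
Bernoulli with parameters `a` and `b`. -/
def minDiv (ρ a b : ℝ) : ℝ :=
  sInf (couplingDiv ρ a b '' Icc (max 0 (a + b - 1)) (min a b))

/-- The binary entropy function `H₂`, in bits. -/
def H2 (t : ℝ) : ℝ :=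
  -t * Real.logb 2 t - (1 - t) * Real.logb 2 (1 - t)

/-- The inverse of the restriction of `H₂` to `[0, 1/2]`. -/
def H2inv : ℝ → ℝ :=
  Function.invFunOn H2 (Icc 0 (1 / 2))

/-- `D₂⁻¹(s) = H₂⁻¹(1 - s)`. -/
def D2inv (s : ℝ) : ℝ :=
  H2inv (1 - s)

/-- The lower envelope `φ(s,t)` of the minimum-relative-entropy region. -/
def phi (ρ s t : ℝ) : ℝ :=
  minDiv ρ (D2inv s) (D2inv t)

/-- The values over which the lower increasing envelope at `(α,β)` is minimized. -/
def phiValues (ρ α β : ℝ) : Set ℝ :=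
  {v | ∃ s ∈ Icc α 1, ∃ t ∈ Icc β 1, v = phi ρ s t}

/-- The lower increasing envelope `φ̃(α,β)`, the minimum of `φ(s,t)` over `s ≥ α`, `t ≥ β`. -/
def phiTilde (ρ α β : ℝ) : ℝ :=
  sInf (phiValues ρ α β)

/-- The unit square `[0,1]²`. -/
def unitSquare : Set (ℝ × ℝ) :=
  Icc 0 1 ×ˢ Icc 0 1

/-- The lower convex envelope of `f` on `S`: the pointwise supremum of the functions that are
convex on `S` and at most `f` on `S`. -/
def lowerConvexEnvelope (S : Set (ℝ × ℝ)) (f : ℝ × ℝ → ℝ) (x : ℝ × ℝ) : ℝ :=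
  sSup {v | ∃ g : ℝ × ℝ → ℝ, ConvexOn ℝ S g ∧ (∀ z ∈ S, g z ≤ f z) ∧ v = g x}

/-- `Θ̲`, the lower convex envelope of `φ̃` on the unit square. -/
def thetaLower (ρ : ℝ) : ℝ × ℝ → ℝ :=
  lowerConvexEnvelope unitSquare fun x => phiTilde ρ x.1 x.2

theorem H2_eq (t : ℝ) : H2 t = Real.binEntropy t / Real.log 2 := by
  rw [H2, Real.binEntropy_eq_negMulLog_add_negMulLog_one_sub]
  simp only [Real.negMulLog, Real.logb]
  ring

/-- `D₂(a) = D((a, 1-a)‖P_X) = 1 - H₂(a)`, where `P_X` is the uniform law on `{0,1}`. -/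
theorem relEntropy_marginal (ρ a : ℝ) :
    relEntropy ![a, 1 - a] (fun x => ∑ y, pXY ρ (x, y)) = 1 - H2 a := by
  have h (x : Fin 2) : ∑ y, pXY ρ (x, y) = 1 / 2 := by
    fin_cases x <;> simp [pXY] <;> ring
  have key (u : ℝ) : u * Real.logb 2 (u / (1 / 2)) = u * Real.logb 2 u + u := by
    rcases eq_or_ne u 0 with rfl | hu
    · simp
    · rw [Real.logb_div hu (by norm_num), Real.logb_div one_ne_zero two_ne_zero,
        Real.logb_one, Real.logb_self_eq_one one_lt_two]
      ring
  simp only [relEntropy, h, Fin.sum_univ_two, Matrix.cons_val_zero, Matrix.cons_val_one, key, H2]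
  ring

theorem H2_bijOn : BijOn H2 (Icc 0 (1 / 2)) (Icc 0 1) := by
  have hl : 0 < Real.log 2 := Real.log_pos one_lt_two
  have hmono : StrictMonoOn H2 (Icc 0 (1 / 2)) := by
    intro x hx y hy hxy
    rw [one_div] at hx hy
    rw [H2_eq, H2_eq]
    exact div_lt_div_of_pos_right (Real.binEntropy_strictMonoOn hx hy hxy) hl
  have h0 : H2 0 = 0 := by simp [H2]
  have h1 : H2 (1 / 2) = 1 := by
    rw [H2_eq, one_div, Real.binEntropy_two_inv, div_self hl.ne']
  have hc : ContinuousOn H2 (Icc 0 (1 / 2)) := by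
    have : H2 = fun t => Real.binEntropy t / Real.log 2 := funext H2_eq
    rw [this]
    exact (Real.binEntropy_continuous.div_const _).continuousOn
  refine ⟨fun x hx => ?_, hmono.injOn, ?_⟩
  · rw [← h0, ← h1]
    exact ⟨hmono.monotoneOn (by norm_num) hx hx.1, hmono.monotoneOn hx (by norm_num) hx.2⟩
  · have := intermediate_value_Icc (by norm_num : (0 : ℝ) ≤ 1 / 2) hc
    rwa [h0, h1] at this

/-- On `[0,1]`, `D₂⁻¹` takes values in `[0, 1/2]` and inverts `D₂ = 1 - H₂`. -/
theorem D2inv_spec {s : ℝ} (hs : s ∈ Icc (0 : ℝ) 1) :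
    D2inv s ∈ Icc (0 : ℝ) (1 / 2) ∧ 1 - H2 (D2inv s) = s := by
  have h : ∃ t ∈ Icc (0 : ℝ) (1 / 2), H2 t = 1 - s :=
    H2_bijOn.surjOn ⟨by linarith [hs.2], by linarith [hs.1]⟩
  have hp := Function.invFunOn_pos h
  refine ⟨hp.1, ?_⟩
  change 1 - H2 (Function.invFunOn H2 (Icc 0 (1 / 2)) (1 - s)) = s
  rw [hp.2]
  ring

/-- The minimum that defines `𝔻₂(a,b)` is attained. -/
theorem minDiv_isLeast {ρ a b : ℝ} (h0 : 0 < ρ) (h1 : ρ < 1)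
    (ha : a ∈ Icc (0 : ℝ) 1) (hb : b ∈ Icc (0 : ℝ) 1) :
    IsLeast (couplingDiv ρ a b '' Icc (max 0 (a + b - 1)) (min a b)) (minDiv ρ a b) := by
  have hne : (Icc (max 0 (a + b - 1)) (min a b)).Nonempty := by
    rw [nonempty_Icc, max_le_iff, le_min_iff, le_min_iff]
    exact ⟨⟨ha.1, hb.1⟩, by linarith [hb.2], by linarith [ha.2]⟩
  have hk {c : ℝ} (hc : c ≠ 0) : Continuous fun u : ℝ => u * Real.logb 2 (u / c) := by
    have : (fun u : ℝ => u * Real.logb 2 (u / c)) =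
        fun u => (u * Real.log u - u * Real.log c) / Real.log 2 := by
      funext u
      rcases eq_or_ne u 0 with rfl | hu
      · simp
      · rw [Real.logb, Real.log_div hu hc]
        ring
    rw [this]
    exact (Real.continuous_mul_log.sub (continuous_id.mul continuous_const)).div_const _
  have hP : (1 + ρ) / 4 ≠ 0 := by positivity
  have hM : (1 - ρ) / 4 ≠ 0 := by
    have : 0 < 1 - ρ := by linarith
    positivity
  have hc : Continuous (couplingDiv ρ a b) := by
    have : couplingDiv ρ a b = fun p =>
        (1 + p - a - b) * Real.logb 2 ((1 + p - a - b) / ((1 + ρ) / 4))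
        + (b - p) * Real.logb 2 ((b - p) / ((1 - ρ) / 4))
        + ((a - p) * Real.logb 2 ((a - p) / ((1 - ρ) / 4))
        + p * Real.logb 2 (p / ((1 + ρ) / 4))) := by
      funext p
      simp [couplingDiv, relEntropy, Fintype.sum_prod_type, coupling, pXY]
    rw [this]
    exact (((hk hP).comp (by fun_prop : Continuous fun p : ℝ => 1 + p - a - b)).add
      ((hk hM).comp (by fun_prop : Continuous fun p : ℝ => b - p))).add
      (((hk hM).comp (by fun_prop : Continuous fun p : ℝ => a - p)).add (hk hP))
  exact (isCompact_Icc.image hc).isLeast_sInf (hne.image _)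

end DSBS

end

noncomputable section

namespace DSBS

open Real

/-! A function with a supporting affine function at every point is convex. For `φ̃` it suffices to
find, at each `(α, β)`, an affine minorant of `φ` with nonnegative slopes `l, m` whose value at `(α,
β)` is at least `φ` at some point above it: this is `HasSupport`.

Minorants come from duality. In nats, the Gibbs principle bounds the divergence below using tilts `u
= lθ`, `v = mη`, and each marginal divergence is a supremum of tilts `θ`. Hence `φ` lies above `l s
+ m t` minus any bound on `log Z(lθ, mη) - l log cosh θ - m log cosh η` over `θ, η ≥ 0`
(`affine_le_phi`).

The crux is `log_tiltMass_le_of_stationary`: a positive stationary point is a global maximum.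
Maximizing out one variable leaves a one-variable function whose derivative changes sign only once,
because the channel map on half log-odds is concave on `[0, ∞)`. The tilted law at that point
attains the bound (`phi_le_of_tilt`). If one marginal already forces enough bias on the other
through the channel, slopes `(1, 0)` or `(0, 1)` suffice; `α = 1` or `β = 1` corresponds to infinite
log-odds. -/

/-! ### The tilted normalizer and the channel map on half log-odds -/

/-- The normalizer `E_P[exp (u σ_X + v σ_Y)]`, where `σ = ±1` marks the two letters. -/
def tiltMass (ρ u v : ℝ) : ℝ :=
  cosh u * cosh v + ρ * (sinh u * sinh v)

/-- The half log-odds of the channel output when the half log-odds of the input is `v`. -/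
def channelOdds (ρ v : ℝ) : ℝ :=
  artanh (ρ * tanh v)

theorem tiltMass_comm (ρ u v : ℝ) : tiltMass ρ u v = tiltMass ρ v u := by
  simp only [tiltMass]; ring

theorem mul_tanh_mem_Ioo {ρ : ℝ} (hρ : ρ ∈ Ioo (0 : ℝ) 1) (v : ℝ) :
    ρ * tanh v ∈ Ioo (-1 : ℝ) 1 := by
  have h1 := tanh_lt_one v
  have h2 := neg_one_lt_tanh v
  constructor <;> nlinarith [hρ.1, hρ.2]

theorem tanh_channelOdds {ρ : ℝ} (hρ : ρ ∈ Ioo (0 : ℝ) 1) (v : ℝ) :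
    tanh (channelOdds ρ v) = ρ * tanh v :=
  tanh_artanh (mul_tanh_mem_Ioo hρ v)

@[simp] theorem channelOdds_zero (ρ : ℝ) : channelOdds ρ 0 = 0 := by
  simp [channelOdds]

theorem sinh_channelOdds {ρ : ℝ} (hρ : ρ ∈ Ioo (0 : ℝ) 1) (v : ℝ) :
    sinh (channelOdds ρ v) = cosh (channelOdds ρ v) * (ρ * (sinh v / cosh v)) := by
  have h := tanh_channelOdds hρ v
  rw [tanh_eq_sinh_div_cosh, tanh_eq_sinh_div_cosh v] at h
  rw [← h, mul_div_cancel₀ _ (cosh_pos _).ne']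

/-- Averaging over `σ_Y` first leaves `σ_X` biased with half log-odds `channelOdds ρ v`, so the
dependence on `u` is a translated `cosh`. -/
theorem tiltMass_eq {ρ : ℝ} (hρ : ρ ∈ Ioo (0 : ℝ) 1) (u v : ℝ) :
    tiltMass ρ u v = cosh v / cosh (channelOdds ρ v) * cosh (u + channelOdds ρ v) := by
  have h1 := (cosh_pos v).ne'
  have h2 := (cosh_pos (channelOdds ρ v)).ne'
  rw [cosh_add, sinh_channelOdds hρ, tiltMass]
  field_simp

theorem tiltMass_pos {ρ : ℝ} (hρ : ρ ∈ Ioo (0 : ℝ) 1) (u v : ℝ) : 0 < tiltMass ρ u v := by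
  have h1 := cosh_pos v
  have h2 := cosh_pos (channelOdds ρ v)
  have h3 := cosh_pos (u + channelOdds ρ v)
  rw [tiltMass_eq hρ]
  positivity

/-- The mean of `σ_X` under the tilted law. -/
theorem tanh_add_channelOdds {ρ : ℝ} (hρ : ρ ∈ Ioo (0 : ℝ) 1) (u v : ℝ) :
    tanh (u + channelOdds ρ v) =
      (sinh u * cosh v + ρ * (cosh u * sinh v)) / tiltMass ρ u v := by
  have h1 := (cosh_pos v).ne'
  have h2 := (cosh_pos (channelOdds ρ v)).ne'
  have h3 := (cosh_pos (u + channelOdds ρ v)).ne'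
  rw [tiltMass_eq hρ, tanh_eq_sinh_div_cosh, sinh_add, sinh_channelOdds hρ]
  field_simp

theorem strictMono_tanh : StrictMono tanh := by
  intro x y hxy
  by_contra h
  push Not at h
  have := artanh_le_artanh (neg_one_lt_tanh y) (tanh_lt_one x) h
  rw [artanh_tanh, artanh_tanh] at this
  linarith

theorem monotone_channelOdds {ρ : ℝ} (hρ : ρ ∈ Ioo (0 : ℝ) 1) : Monotone (channelOdds ρ) := by
  intro x y hxy
  refine artanh_le_artanh (mul_tanh_mem_Ioo hρ x).1 (mul_tanh_mem_Ioo hρ y).2 ?_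
  exact mul_le_mul_of_nonneg_left (strictMono_tanh.monotone hxy) hρ.1.le

theorem channelOdds_nonneg {ρ : ℝ} (hρ : ρ ∈ Ioo (0 : ℝ) 1) {v : ℝ} (hv : 0 ≤ v) :
    0 ≤ channelOdds ρ v := by
  have := monotone_channelOdds hρ hv
  rwa [channelOdds_zero] at this

theorem hasDerivAt_channelOdds {ρ : ℝ} (hρ : ρ ∈ Ioo (0 : ℝ) 1) (v : ℝ) :
    HasDerivAt (channelOdds ρ) (ρ / (1 + (1 - ρ ^ 2) * sinh v ^ 2)) v := by
  have key : channelOdds ρ =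
      fun v => 1 / 2 * (log (cosh v + ρ * sinh v) - log (cosh v - ρ * sinh v)) := by
    funext v
    have hv := mul_tanh_mem_Ioo hρ v
    have hc := cosh_pos v
    have e1 : 1 + ρ * tanh v = (cosh v + ρ * sinh v) / cosh v := by
      rw [tanh_eq_sinh_div_cosh]; field_simp
    have e2 : 1 - ρ * tanh v = (cosh v - ρ * sinh v) / cosh v := by
      rw [tanh_eq_sinh_div_cosh]; field_simp
    have p1 : 0 < (cosh v + ρ * sinh v) / cosh v := by rw [← e1]; linarith [hv.1]
    have p2 : 0 < (cosh v - ρ * sinh v) / cosh v := by rw [← e2]; linarith [hv.2]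
    rw [channelOdds, artanh_eq_half_log ⟨hv.1.le, hv.2.le⟩, e1, e2, div_div_div_cancel_right₀ hc.ne',
      log_div]
    · exact fun h => by simp [h] at p1
    · exact fun h => by simp [h] at p2
  have hv := mul_tanh_mem_Ioo hρ v
  have hc := cosh_pos v
  have p1 : 0 < cosh v + ρ * sinh v := by
    have := mul_pos hc (by linarith [hv.1] : 0 < 1 + ρ * tanh v)
    rw [tanh_eq_sinh_div_cosh] at this
    field_simp at this
    linarith
  have p2 : 0 < cosh v - ρ * sinh v := by
    have := mul_pos hc (by linarith [hv.2] : 0 < 1 - ρ * tanh v)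
    rw [tanh_eq_sinh_div_cosh] at this
    field_simp at this
    linarith
  have hd : (cosh v + ρ * sinh v) * (cosh v - ρ * sinh v) = 1 + (1 - ρ ^ 2) * sinh v ^ 2 := by
    have := cosh_sq v
    linear_combination this
  rw [key, ← hd]
  have d1 := ((hasDerivAt_cosh v).add ((hasDerivAt_sinh v).const_mul ρ)).log p1.ne'
  have d2 := ((hasDerivAt_cosh v).sub ((hasDerivAt_sinh v).const_mul ρ)).log p2.ne'
  refine ((d1.sub d2).const_mul (1 / 2)).congr_deriv ?_
  simp only [Pi.add_apply, Pi.sub_apply]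
  rw [div_sub_div _ _ p1.ne' p2.ne', mul_div_assoc', div_left_inj' (mul_pos p1 p2).ne']
  linear_combination ρ * cosh_sq v

theorem concaveOn_channelOdds {ρ : ℝ} (hρ : ρ ∈ Ioo (0 : ℝ) 1) :
    ConcaveOn ℝ (Ici 0) (channelOdds ρ) := by
  refine AntitoneOn.concaveOn_of_deriv (convex_Ici 0)
    (fun v _ => (hasDerivAt_channelOdds hρ v).continuousAt.continuousWithinAt)
    (fun v _ => (hasDerivAt_channelOdds hρ v).differentiableAt.differentiableWithinAt) ?_
  rw [interior_Ici]
  intro x hx y hy hxy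
  rw [(hasDerivAt_channelOdds hρ x).deriv, (hasDerivAt_channelOdds hρ y).deriv]
  have hs : 0 ≤ sinh x := sinh_nonneg_iff.mpr (le_of_lt hx)
  have hxy' : sinh x ≤ sinh y := sinh_le_sinh.mpr hxy
  have h1 : 0 ≤ 1 - ρ ^ 2 := by nlinarith [hρ.1, hρ.2]
  have := hρ.1.le
  gcongr

/-- This round trip through the channel is what remains of the stationarity equations once one
variable is eliminated; its concavity gives uniqueness of the sign change. -/
theorem concaveOn_channelOdds_iterate {ρ : ℝ} (hρ : ρ ∈ Ioo (0 : ℝ) 1) {k μ : ℝ} (hk : 0 ≤ k)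
    (hμ : 0 ≤ μ) :
    ConcaveOn ℝ (Ici 0) fun t => channelOdds ρ (k * channelOdds ρ (μ * t)) := by
  refine ⟨convex_Ici 0, fun x hx y hy a b ha hb hab => ?_⟩
  simp only [smul_eq_mul]
  have hx' : 0 ≤ μ * x := mul_nonneg hμ hx
  have hy' : 0 ≤ μ * y := mul_nonneg hμ hy
  have h1 := (concaveOn_channelOdds hρ).2 hx' hy' ha hb hab
  have h2 := (concaveOn_channelOdds hρ).2 (mul_nonneg hk (channelOdds_nonneg hρ hx'))
    (mul_nonneg hk (channelOdds_nonneg hρ hy')) ha hb hab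
  simp only [smul_eq_mul] at h1 h2
  refine h2.trans (monotone_channelOdds hρ ?_)
  have h3 := mul_le_mul_of_nonneg_left h1 hk
  rw [show μ * (a * x + b * y) = a * (μ * x) + b * (μ * y) by ring]
  linarith

/-! ### Maximizing the tilted log-moment functional -/

/-- A function increasing up to `c` and decreasing after `c` is maximal at `c`. -/
theorem le_of_deriv_sign {f f' : ℝ → ℝ} {c : ℝ} (hc : 0 ≤ c) (hf : ∀ t, HasDerivAt f (f' t) t)
    (h1 : ∀ t, 0 ≤ t → t ≤ c → 0 ≤ f' t) (h2 : ∀ t, c ≤ t → f' t ≤ 0) {t : ℝ} (ht : 0 ≤ t) :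
    f t ≤ f c := by
  rcases le_total t c with h | h
  · refine monotoneOn_of_deriv_nonneg (convex_Icc 0 c)
      (fun x _ => (hf x).continuousAt.continuousWithinAt)
      (fun x _ => (hf x).differentiableAt.differentiableWithinAt) (fun x hx => ?_)
      ⟨ht, h⟩ ⟨hc, le_rfl⟩ h
    rw [interior_Icc] at hx
    rw [(hf x).deriv]
    exact h1 x hx.1.le hx.2.le
  · refine antitoneOn_of_deriv_nonpos (convex_Ici c)
      (fun x _ => (hf x).continuousAt.continuousWithinAt)
      (fun x _ => (hf x).differentiableAt.differentiableWithinAt) (fun x hx => ?_)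
      self_mem_Ici h h
    rw [interior_Ici] at hx
    rw [(hf x).deriv]
    exact h2 x (le_of_lt hx)

theorem hasDerivAt_log_cosh {f : ℝ → ℝ} {f' t : ℝ} (hf : HasDerivAt f f' t) :
    HasDerivAt (fun t => log (cosh (f t))) (tanh (f t) * f') t := by
  refine (hf.cosh.log (cosh_pos _).ne').congr_deriv ?_
  rw [tanh_eq_sinh_div_cosh]; ring

/-- The derivative `l (tanh (l t + r) - tanh t)` changes sign at the fixed point `r / (1 - l)` of `t
↦ l t + r`. -/
theorem log_cosh_add_sub_le {l r t : ℝ} (hl0 : 0 ≤ l) (hl1 : l < 1) (hr : 0 ≤ r) (ht : 0 ≤ t) :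
    log (cosh (l * t + r)) - l * log (cosh t) ≤
      log (cosh (l * (r / (1 - l)) + r)) - l * log (cosh (r / (1 - l))) := by
  have h1 : 0 < 1 - l := by linarith
  refine le_of_deriv_sign (f := fun t => log (cosh (l * t + r)) - l * log (cosh t))
    (f' := fun t => tanh (l * t + r) * l - l * (tanh t * 1)) (div_nonneg hr h1.le) (fun t => ?_)
    (fun t _ h => ?_) (fun t h => ?_) ht
  · have d1 : HasDerivAt (fun t : ℝ => l * t + r) l t := by
      simpa using ((hasDerivAt_id t).const_mul l).add_const r
    exact (hasDerivAt_log_cosh d1).sub ((hasDerivAt_log_cosh (hasDerivAt_id t)).const_mul l)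
  · rw [le_div_iff₀ h1] at h
    have := strictMono_tanh.monotone (by linarith : t ≤ l * t + r)
    nlinarith
  · rw [div_le_iff₀ h1] at h
    have := strictMono_tanh.monotone (by linarith : l * t + r ≤ t)
    nlinarith

theorem hasDerivAt_log_tiltMass {ρ : ℝ} (hρ : ρ ∈ Ioo (0 : ℝ) 1) {f g : ℝ → ℝ} {f' g' t : ℝ}
    (hf : HasDerivAt f f' t) (hg : HasDerivAt g g' t) :
    HasDerivAt (fun t => log (tiltMass ρ (f t) (g t)))
      (tanh (f t + channelOdds ρ (g t)) * f' + tanh (g t + channelOdds ρ (f t)) * g') t := by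
  have hp := (tiltMass_pos hρ (f t) (g t)).ne'
  have := ((hf.cosh.mul hg.cosh).add ((hf.sinh.mul hg.sinh).const_mul ρ)).log hp
  refine this.congr_deriv ?_
  rw [tanh_add_channelOdds hρ, tanh_add_channelOdds hρ, tiltMass_comm ρ (g t)]
  change _ / tiltMass ρ (f t) (g t) = _
  field_simp
  ring

theorem channelOdds_pos {ρ : ℝ} (hρ : ρ ∈ Ioo (0 : ℝ) 1) {v : ℝ} (hv : 0 < v) :
    0 < channelOdds ρ v := by
  have h : 0 < tanh v := by simpa using strictMono_tanh hv
  exact artanh_pos ⟨mul_pos hρ.1 h, (mul_tanh_mem_Ioo hρ v).2⟩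

/-- The tilted log-moment functional attains its maximum at a positive stationary point. -/
theorem log_tiltMass_le_of_stationary {ρ : ℝ} (hρ : ρ ∈ Ioo (0 : ℝ) 1) {x y θ η : ℝ} (hx : 0 < x)
    (hy : 0 < y) (hθ : θ = x + channelOdds ρ y) (hη : η = y + channelOdds ρ x) {s t : ℝ}
    (hs : 0 ≤ s) (ht : 0 ≤ t) :
    log (tiltMass ρ (x / θ * s) (y / η * t)) - x / θ * log (cosh s) - y / η * log (cosh t) ≤
      log (tiltMass ρ x y) - x / θ * log (cosh θ) - y / η * log (cosh η) := by
  have hAx := channelOdds_pos hρ hx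
  have hAy := channelOdds_pos hρ hy
  have hθ0 : 0 < θ := by linarith
  have hη0 : 0 < η := by linarith
  have hlθ : x / θ * θ = x := div_mul_cancel₀ _ hθ0.ne'
  have hmη : y / η * η = y := div_mul_cancel₀ _ hη0.ne'
  have hl0 : 0 < x / θ := div_pos hx hθ0
  have hm0 : 0 < y / η := div_pos hy hη0
  have hl1 : x / θ < 1 := (div_lt_one hθ0).2 (by linarith)
  generalize x / θ = l at *
  generalize y / η = m at *
  have hl1' : 0 < 1 - l := by linarith
  -- `S t` is the best first variable for a given `t`.
  set S : ℝ → ℝ := fun t => channelOdds ρ (m * t) / (1 - l) with hS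
  have hSη : S η = θ := by
    rw [hS]
    simp only
    rw [hmη, div_eq_iff hl1'.ne']
    linarith
  have step1 : log (tiltMass ρ (l * s) (m * t)) - l * log (cosh s) ≤
      log (tiltMass ρ (l * S t) (m * t)) - l * log (cosh (S t)) := by
    have h := log_cosh_add_sub_le hl0.le hl1 (channelOdds_nonneg hρ (mul_nonneg hm0.le ht)) hs
    have e (u : ℝ) : log (tiltMass ρ u (m * t)) =
        log (cosh (m * t) / cosh (channelOdds ρ (m * t))) +
          log (cosh (u + channelOdds ρ (m * t))) := by
      rw [tiltMass_eq hρ, log_mul (div_pos (cosh_pos _) (cosh_pos _)).ne' (cosh_pos _).ne']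
    rw [e, e]
    linarith
  have hbal (t : ℝ) : l * S t + channelOdds ρ (m * t) = S t := by
    have : S t * (1 - l) = channelOdds ρ (m * t) := div_mul_cancel₀ _ hl1'.ne'
    linarith
  have hconc := concaveOn_channelOdds_iterate hρ (div_nonneg hl0.le hl1'.le) hm0.le
  have hcomp (t : ℝ) : channelOdds ρ (l / (1 - l) * channelOdds ρ (m * t)) =
      channelOdds ρ (l * S t) := by
    rw [hS]; simp only; congr 1; ring
  simp only [hcomp] at hconc
  have hk0 : channelOdds ρ (l * S 0) = 0 := by simp [hS]
  have hkη : channelOdds ρ (l * S η) = (1 - m) * η := by rw [hSη, hlθ]; linarith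
  have step2 : log (tiltMass ρ (l * S t) (m * t)) - l * log (cosh (S t)) - m * log (cosh t) ≤
      log (tiltMass ρ (l * S η) (m * η)) - l * log (cosh (S η)) - m * log (cosh η) := by
    -- The terms containing the derivative of `S` cancel by `hbal`, as in the envelope theorem.
    refine le_of_deriv_sign
      (f := fun t => log (tiltMass ρ (l * S t) (m * t)) - l * log (cosh (S t)) - m * log (cosh t))
      (f' := fun t => m * (tanh (m * t + channelOdds ρ (l * S t)) - tanh t)) hη0.le
      (fun t => ?_) (fun t h0 h1 => ?_) (fun t h => ?_) ht
    · have dm : HasDerivAt (fun t : ℝ => m * t) m t := by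
        simpa using (hasDerivAt_id t).const_mul m
      have dS := ((hasDerivAt_channelOdds hρ (m * t)).comp t dm).div_const (1 - l)
      refine (((hasDerivAt_log_tiltMass hρ (dS.const_mul l) dm).sub
        ((hasDerivAt_log_cosh dS).const_mul l)).sub
        ((hasDerivAt_log_cosh (hasDerivAt_id t)).const_mul m)).congr_deriv ?_
      have := hbal t
      simp only [hS] at this
      simp only [Function.comp_apply, id, hS, this]
      ring
    · refine mul_nonneg hm0.le (sub_nonneg.2 (strictMono_tanh.monotone ?_))
      -- The concave function `channelOdds ρ (l * S t)` meets the line `(1 - m) * t` at `0` and at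
      -- `η`: it lies above the line between them and below it afterwards.
      have h2 := hconc.2 (mem_Ici.2 le_rfl) (mem_Ici.2 hη0.le)
        (sub_nonneg.2 ((div_le_one hη0).2 h1)) (div_nonneg h0 hη0.le) (sub_add_cancel _ _)
      simp only [smul_eq_mul, hk0, hkη, mul_zero, zero_add] at h2
      rw [div_mul_cancel₀ _ hη0.ne', mul_left_comm, div_mul_cancel₀ _ hη0.ne'] at h2
      linarith
    · refine mul_nonpos_of_nonneg_of_nonpos hm0.le (sub_nonpos.2 (strictMono_tanh.monotone ?_))
      have ht0 : 0 < t := hη0.trans_le h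
      have h2 := hconc.2 (mem_Ici.2 le_rfl) (mem_Ici.2 ht0.le)
        (sub_nonneg.2 ((div_le_one ht0).2 h)) (div_nonneg hη0.le ht0.le) (sub_add_cancel _ _)
      simp only [smul_eq_mul, hk0, mul_zero, zero_add] at h2
      rw [div_mul_cancel₀ _ ht0.ne', hkη, div_mul_eq_mul_div, div_le_iff₀ ht0] at h2
      have : channelOdds ρ (l * S t) ≤ (1 - m) * t :=
        le_of_mul_le_mul_left (by linarith) hη0
      linarith
  rw [hSη, hlθ, hmη] at step2
  linarith

theorem log_cosh_sub_le {r l t : ℝ} (hr : 0 < r) (hl : 0 ≤ l) (hl1 : l < 1) (ht : 0 ≤ t)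
    {η : ℝ} (hη : l * η + r = η) :
    log (cosh (l * t + r)) - l * log (cosh t) ≤ log (cosh η) - l * log (cosh η) := by
  have h1 : 0 < 1 - l := by linarith
  have e : r / (1 - l) = η := by rw [div_eq_iff h1.ne']; linarith
  have := log_cosh_add_sub_le hl hl1 hr.le ht
  rwa [e, hη] at this

/-- For a deterministic input the normalizer is a translate of `cosh`. -/
theorem cosh_add_mul_sinh {ρ : ℝ} (hρ : ρ ∈ Ioo (0 : ℝ) 1) (v : ℝ) :
    cosh v + ρ * sinh v = cosh (v + artanh ρ) / cosh (artanh ρ) := by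
  have hc := (cosh_pos (artanh ρ)).ne'
  have h := tanh_artanh (x := ρ) ⟨by linarith [hρ.1], hρ.2⟩
  have hs : sinh (artanh ρ) = ρ * cosh (artanh ρ) := by
    rw [tanh_eq_sinh_div_cosh, div_eq_iff hc] at h
    exact h
  rw [cosh_add, hs]
  field_simp

theorem cosh_add_mul_sinh_pos {ρ : ℝ} (hρ : ρ ∈ Ioo (0 : ℝ) 1) (v : ℝ) :
    0 < cosh v + ρ * sinh v := by
  rw [cosh_add_mul_sinh hρ]
  exact div_pos (cosh_pos _) (cosh_pos _)

/-- The right-hand side is the limit of the functional as `s → ∞` at `t = η`; bounding `sinh s` by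
`cosh s` removes `s`. -/
theorem log_tiltMass_le_of_deterministic {ρ : ℝ} (hρ : ρ ∈ Ioo (0 : ℝ) 1) {y η : ℝ} (hy : 0 ≤ y)
    (hη : η = y + artanh ρ) {s t : ℝ} (ht : 0 ≤ t) :
    log (tiltMass ρ (1 * s) (y / η * t)) - 1 * log (cosh s) - y / η * log (cosh t) ≤
      log (cosh y + ρ * sinh y) - y / η * log (cosh η) := by
  have hr : 0 < artanh ρ := artanh_pos hρ
  have hη0 : 0 < η := by linarith
  have hmη : y / η * η = y := div_mul_cancel₀ _ hη0.ne'
  have hm0 : 0 ≤ y / η := div_nonneg hy hη0.le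
  have hm1 : y / η < 1 := (div_lt_one hη0).2 (by linarith)
  generalize y / η = m at *
  have hsinh : 0 ≤ sinh (m * t) := sinh_nonneg_iff.2 (mul_nonneg hm0 ht)
  have h1 : tiltMass ρ (1 * s) (m * t) ≤ cosh s * (cosh (m * t) + ρ * sinh (m * t)) := by
    have : sinh s ≤ cosh s := (sinh_lt_cosh s).le
    have := mul_le_mul_of_nonneg_right this hsinh
    have := mul_le_mul_of_nonneg_left this hρ.1.le
    rw [tiltMass, one_mul]
    linarith
  have h2 := log_le_log (tiltMass_pos hρ _ _) h1
  rw [log_mul (cosh_pos s).ne' (cosh_add_mul_sinh_pos hρ _).ne', cosh_add_mul_sinh hρ,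
    log_div (cosh_pos _).ne' (cosh_pos _).ne'] at h2
  have h3 := log_cosh_sub_le hr hm0 hm1 ht (η := η) (by linarith)
  rw [cosh_add_mul_sinh hρ, log_div (cosh_pos _).ne' (cosh_pos _).ne', ← hη]
  linarith

theorem log_tiltMass_one_one_le {ρ : ℝ} (hρ : ρ ∈ Ioo (0 : ℝ) 1) (s t : ℝ) :
    log (tiltMass ρ (1 * s) (1 * t)) - 1 * log (cosh s) - 1 * log (cosh t) ≤ log (1 + ρ) := by
  have h1 : tiltMass ρ (1 * s) (1 * t) ≤ (1 + ρ) * (cosh s * cosh t) := by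
    have : sinh s * sinh t ≤ cosh s * cosh t := by
      have := cosh_pos (s - t)
      rw [cosh_sub] at this
      linarith
    have := mul_le_mul_of_nonneg_left this hρ.1.le
    rw [tiltMass, one_mul, one_mul]
    linarith
  have h2 := log_le_log (tiltMass_pos hρ _ _) h1
  have hp : 1 + ρ ≠ 0 := by linarith [hρ.1]
  rw [log_mul hp (mul_pos (cosh_pos s) (cosh_pos t)).ne',
    log_mul (cosh_pos s).ne' (cosh_pos t).ne'] at h2
  linarith

/-! ### The Gibbs lower bound, in nats -/

theorem couplingDiv_mul_log_two (ρ a b p : ℝ) : couplingDiv ρ a b p * log 2 =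
    (1 + p - a - b) * log ((1 + p - a - b) / ((1 + ρ) / 4))
      + (b - p) * log ((b - p) / ((1 - ρ) / 4))
      + ((a - p) * log ((a - p) / ((1 - ρ) / 4)) + p * log (p / ((1 + ρ) / 4))) := by
  have hl : log 2 ≠ 0 := (log_pos one_lt_two).ne'
  simp only [couplingDiv, relEntropy, Fintype.sum_prod_type, coupling, pXY, Fin.sum_univ_two,
    logb, Matrix.of_apply, Matrix.cons_val_zero, Matrix.cons_val_one, Matrix.cons_val']
  field_simp

theorem couplingDiv_comm (ρ a b p : ℝ) : couplingDiv ρ a b p = couplingDiv ρ b a p := by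
  have hl : log 2 ≠ 0 := (log_pos one_lt_two).ne'
  refine mul_right_cancel₀ hl ?_
  rw [couplingDiv_mul_log_two, couplingDiv_mul_log_two, show 1 + p - a - b = 1 + p - b - a by ring]
  ring

theorem phi_comm (ρ s t : ℝ) : phi ρ s t = phi ρ t s := by
  have h (a b : ℝ) : couplingDiv ρ a b = couplingDiv ρ b a := funext (couplingDiv_comm ρ a b)
  rw [phi, phi, minDiv, minDiv, h, add_comm, min_comm]

/-- This is `log x ≤ x - 1` at `x = P e^h / (Z q)`. The corrections `q - P e^h / Z` cancel when
summed over the four atoms. -/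
theorem mul_log_div_ge {q P h Z : ℝ} (hq : 0 ≤ q) (hP : 0 < P) (hZ : 0 < Z) :
    q * (h - log Z) + (q - P * exp h / Z) ≤ q * log (q / P) := by
  rcases hq.eq_or_lt with rfl | hq
  · have : 0 < P * exp h / Z := by positivity
    simp only [zero_mul, zero_add, zero_sub]
    linarith
  · have h1 := log_le_sub_one_of_pos (show 0 < P * exp h / (Z * q) by positivity)
    rw [log_div (by positivity) (by positivity), log_mul hP.ne' (exp_pos h).ne', log_exp,
      log_mul hZ.ne' hq.ne'] at h1
    have h2 := mul_le_mul_of_nonneg_left h1 hq.le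
    have e : q * (P * exp h / (Z * q) - 1) = P * exp h / Z - q := by
      field_simp
    rw [e] at h2
    rw [log_div hq.ne' hP.ne']
    linarith

theorem tiltMass_eq_exp (ρ u v : ℝ) : tiltMass ρ u v =
    (1 + ρ) / 4 * exp (u + v) + (1 - ρ) / 4 * exp (u - v)
      + ((1 - ρ) / 4 * exp (-u + v) + (1 + ρ) / 4 * exp (-u - v)) := by
  simp only [tiltMass, cosh_eq, sinh_eq, sub_eq_add_neg, exp_add]
  ring

/-- The Gibbs variational principle for the tilts `u σ_X + v σ_Y`. -/
theorem couplingDiv_ge {ρ a b p : ℝ} (hρ : ρ ∈ Ioo (0 : ℝ) 1)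
    (hp : p ∈ Icc (max 0 (a + b - 1)) (min a b)) (u v : ℝ) :
    u * (1 - 2 * a) + v * (1 - 2 * b) - log (tiltMass ρ u v) ≤ couplingDiv ρ a b p * log 2 := by
  have hP : 0 < (1 + ρ) / 4 := by linarith [hρ.1]
  have hM : 0 < (1 - ρ) / 4 := by linarith [hρ.2]
  have hZ := tiltMass_pos hρ u v
  have p0 : 0 ≤ p := (le_max_left _ _).trans hp.1
  have p1 : 0 ≤ 1 + p - a - b := by linarith [(le_max_right _ _).trans hp.1]
  have p2 : 0 ≤ a - p := by linarith [hp.2.trans (min_le_left _ _)]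
  have p3 : 0 ≤ b - p := by linarith [hp.2.trans (min_le_right _ _)]
  have h00 := mul_log_div_ge (h := u + v) p1 hP hZ
  have h01 := mul_log_div_ge (h := u - v) p3 hM hZ
  have h10 := mul_log_div_ge (h := -u + v) p2 hM hZ
  have h11 := mul_log_div_ge (h := -u - v) p0 hP hZ
  have hsum : (1 + ρ) / 4 * exp (u + v) / tiltMass ρ u v
      + (1 - ρ) / 4 * exp (u - v) / tiltMass ρ u v
      + ((1 - ρ) / 4 * exp (-u + v) / tiltMass ρ u v
        + (1 + ρ) / 4 * exp (-u - v) / tiltMass ρ u v) = 1 := by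
    rw [← add_div, ← add_div, ← add_div, ← tiltMass_eq_exp, div_self hZ.ne']
  rw [couplingDiv_mul_log_two]
  linarith

/-! ### Marginal divergence in terms of half log-odds -/

theorem one_add_tanh (θ : ℝ) : (1 + tanh θ) / 2 = exp θ / (2 * cosh θ) := by
  have := (cosh_pos θ).ne'
  rw [tanh_eq_sinh_div_cosh, ← cosh_add_sinh]
  field_simp

theorem one_sub_tanh (θ : ℝ) : (1 - tanh θ) / 2 = exp (-θ) / (2 * cosh θ) := by
  have := (cosh_pos θ).ne'
  rw [tanh_eq_sinh_div_cosh, ← cosh_sub_sinh]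
  field_simp

theorem log_one_add_tanh (θ : ℝ) : log ((1 + tanh θ) / 2) = θ - (log 2 + log (cosh θ)) := by
  have := (cosh_pos θ).ne'
  rw [one_add_tanh, log_div (exp_pos _).ne' (by positivity), log_exp, log_mul two_ne_zero this]

theorem log_one_sub_tanh (θ : ℝ) : log ((1 - tanh θ) / 2) = -θ - (log 2 + log (cosh θ)) := by
  have := (cosh_pos θ).ne'
  rw [one_sub_tanh, log_div (exp_pos _).ne' (by positivity), log_exp, log_mul two_ne_zero this]

/-- The relative entropy to the uniform law, in bits, at half log-odds `θ`. -/
def divOfOdds (θ : ℝ) : ℝ :=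
  1 - H2 ((1 - tanh θ) / 2)

theorem divOfOdds_mul_log_two (θ : ℝ) :
    divOfOdds θ * log 2 = θ * tanh θ - log (cosh θ) := by
  have hl : log 2 ≠ 0 := (log_pos one_lt_two).ne'
  rw [divOfOdds, H2, show 1 - (1 - tanh θ) / 2 = (1 + tanh θ) / 2 by ring, logb, logb,
    log_one_add_tanh, log_one_sub_tanh]
  field_simp
  ring

theorem one_sub_tanh_mem {θ : ℝ} (hθ : 0 ≤ θ) : (1 - tanh θ) / 2 ∈ Icc (0 : ℝ) (1 / 2) := by
  have h1 := tanh_lt_one θ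
  have h2 : 0 ≤ tanh θ := by simpa using strictMono_tanh.monotone hθ
  constructor <;> linarith

theorem D2inv_one_sub_H2 {a : ℝ} (ha : a ∈ Icc (0 : ℝ) (1 / 2)) : D2inv (1 - H2 a) = a := by
  have h := H2_bijOn.mapsTo ha
  have hs := D2inv_spec (s := 1 - H2 a) ⟨by linarith [h.2], by linarith [h.1]⟩
  exact H2_bijOn.injOn hs.1 ha (by linarith [hs.2])

theorem D2inv_divOfOdds {θ : ℝ} (hθ : 0 ≤ θ) : D2inv (divOfOdds θ) = (1 - tanh θ) / 2 :=
  D2inv_one_sub_H2 (one_sub_tanh_mem hθ)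

theorem D2inv_one : D2inv 1 = 0 := by
  have := D2inv_one_sub_H2 (a := 0) (by norm_num)
  simpa [H2] using this

theorem divOfOdds_mem {θ : ℝ} (hθ : 0 ≤ θ) : divOfOdds θ ∈ Icc (0 : ℝ) 1 := by
  have h := H2_bijOn.mapsTo (one_sub_tanh_mem hθ)
  exact ⟨by linarith [h.2, divOfOdds.eq_def θ], by linarith [h.1, divOfOdds.eq_def θ]⟩

theorem divOfOdds_le {θ η : ℝ} (hθ : 0 ≤ θ) (h : θ ≤ η) : divOfOdds θ ≤ divOfOdds η := by
  have h1 := (one_sub_tanh_mem hθ)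
  have h2 := (one_sub_tanh_mem (hθ.trans h))
  have h3 := strictMono_tanh.monotone h
  rw [one_div] at h1 h2
  have := binEntropy_strictMonoOn.monotoneOn h2 h1 (by linarith)
  rw [divOfOdds, divOfOdds, H2_eq, H2_eq]
  have hl : 0 < log 2 := log_pos one_lt_two
  gcongr

theorem exists_divOfOdds {s : ℝ} (hs : s ∈ Ico (0 : ℝ) 1) : ∃ θ, 0 ≤ θ ∧ divOfOdds θ = s := by
  obtain ⟨ha, hsa⟩ := D2inv_spec (s := s) ⟨hs.1, hs.2.le⟩
  have ha0 : 0 < D2inv s := by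
    refine ha.1.lt_of_ne fun h => ?_
    rw [← h] at hsa
    simp only [H2, neg_zero, zero_mul, sub_zero, logb_one, mul_zero] at hsa
    linarith [hs.2]
  refine ⟨artanh (1 - 2 * D2inv s), artanh_nonneg (by linarith [ha.2]), ?_⟩
  rw [divOfOdds, tanh_artanh ⟨by linarith [ha.2], by linarith⟩]
  convert hsa using 3
  ring

/-- The relative entropy to the uniform law is the supremum of its linear tilts. -/
theorem exists_tilt {s ε : ℝ} (hs : s ∈ Icc (0 : ℝ) 1) (hε : 0 < ε) :
    ∃ θ, 0 ≤ θ ∧ s * log 2 - ε ≤ θ * (1 - 2 * D2inv s) - log (cosh θ) := by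
  rcases hs.2.lt_or_eq with h | rfl
  · obtain ⟨θ, h0, rfl⟩ := exists_divOfOdds ⟨hs.1, h⟩
    refine ⟨θ, h0, ?_⟩
    rw [divOfOdds_mul_log_two, D2inv_divOfOdds h0]
    have : θ * (1 - 2 * ((1 - tanh θ) / 2)) = θ * tanh θ := by ring
    linarith
  -- At `s = 1` the supremum is only approached as `θ → ∞`, with error at most `exp (-2θ)`; hence
  -- the slack `ε`.
  · rw [D2inv_one]
    obtain ⟨θ, h0, hθ⟩ : ∃ θ, 0 ≤ θ ∧ exp (-(2 * θ)) ≤ ε := by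
      refine ⟨max 0 (-log ε / 2), le_max_left _ _, ?_⟩
      rw [← log_le_log_iff (exp_pos _) hε, log_exp]
      linarith [le_max_right 0 (-log ε / 2)]
    refine ⟨θ, h0, ?_⟩
    have e : cosh θ = exp θ / 2 * (1 + exp (-(2 * θ))) := by
      have : exp (-(2 * θ)) = exp (-θ) * exp (-θ) := by rw [← exp_add]; ring_nf
      have h1 : exp θ * exp (-θ) = 1 := by rw [← exp_add]; simp
      rw [cosh_eq, this]
      linear_combination (-exp (-θ) / 2) * h1
    have h2 := log_le_sub_one_of_pos (show 0 < 1 + exp (-(2 * θ)) by positivity)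
    rw [e, log_mul (by positivity) (by positivity), log_div (exp_pos _).ne' two_ne_zero, log_exp]
    linarith

/-! ### Affine minorants of `φ` and matching upper bounds -/

/-- An upper bound on the tilted log-moment functional gives an affine minorant of `φ`. -/
theorem affine_le_phi {ρ l m K : ℝ} (hρ : ρ ∈ Ioo (0 : ℝ) 1) (hl : 0 ≤ l) (hm : 0 ≤ m)
    (hK : ∀ θ η : ℝ, 0 ≤ θ → 0 ≤ η →
      log (tiltMass ρ (l * θ) (m * η)) - l * log (cosh θ) - m * log (cosh η) ≤ K)
    {s t : ℝ} (hs : s ∈ Icc (0 : ℝ) 1) (ht : t ∈ Icc (0 : ℝ) 1) :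
    l * s + m * t - K / log 2 ≤ phi ρ s t := by
  have hl2 : 0 < log 2 := log_pos one_lt_two
  obtain ⟨ha, -⟩ := D2inv_spec hs
  obtain ⟨hb, -⟩ := D2inv_spec ht
  obtain ⟨⟨p, hp, hpv⟩, -⟩ := minDiv_isLeast hρ.1 hρ.2 (a := D2inv s) (b := D2inv t)
    ⟨ha.1, by linarith [ha.2]⟩ ⟨hb.1, by linarith [hb.2]⟩
  rw [phi, ← hpv, ← mul_le_mul_iff_left₀ hl2]
  refine le_of_forall_pos_le_add fun ε hε => ?_
  have hlm : 0 < l + m + 1 := by linarith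
  obtain ⟨θ, hθ0, hθ⟩ := exists_tilt hs (div_pos hε hlm)
  obtain ⟨η, hη0, hη⟩ := exists_tilt ht (div_pos hε hlm)
  have h1 := mul_le_mul_of_nonneg_left hθ hl
  have h2 := mul_le_mul_of_nonneg_left hη hm
  have h3 := couplingDiv_ge hρ hp (l * θ) (m * η)
  have h4 := hK θ η hθ0 hη0
  have h5 : ε / (l + m + 1) * (l + m + 1) = ε := div_mul_cancel₀ _ hlm.ne'
  have h6 : 0 < ε / (l + m + 1) := div_pos hε hlm
  have h7 : K / log 2 * log 2 = K := div_mul_cancel₀ _ hl2.ne'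
  rw [sub_mul, h7]
  linarith

theorem minDiv_le {ρ a b p : ℝ} (hρ : ρ ∈ Ioo (0 : ℝ) 1)
    (ha : a ∈ Icc (0 : ℝ) (1 / 2)) (hb : b ∈ Icc (0 : ℝ) (1 / 2))
    (hp : p ∈ Icc (max 0 (a + b - 1)) (min a b)) : minDiv ρ a b ≤ couplingDiv ρ a b p :=
  (minDiv_isLeast hρ.1 hρ.2 ⟨ha.1, by linarith [ha.2]⟩ ⟨hb.1, by linarith [hb.2]⟩).2
    (mem_image_of_mem _ hp)

/-- The value of `φ` on the tilted laws. -/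
theorem phi_le_of_tilt {ρ x y θ η : ℝ} (hρ : ρ ∈ Ioo (0 : ℝ) 1)
    (hθ : θ = x + channelOdds ρ y) (hη : η = y + channelOdds ρ x) (hθ0 : 0 ≤ θ) (hη0 : 0 ≤ η) :
    phi ρ (divOfOdds θ) (divOfOdds η) * log 2 ≤
      x * tanh θ + y * tanh η - log (tiltMass ρ x y) := by
  have hl2 : 0 < log 2 := log_pos one_lt_two
  have hZ := tiltMass_pos hρ x y
  have hP : 0 < (1 + ρ) / 4 := by linarith [hρ.1]
  have hM : 0 < (1 - ρ) / 4 := by linarith [hρ.2]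
  rw [phi, D2inv_divOfOdds hθ0, D2inv_divOfOdds hη0]
  have hX : tanh θ * tiltMass ρ x y = sinh x * cosh y + ρ * (cosh x * sinh y) := by
    rw [hθ, tanh_add_channelOdds hρ, div_mul_cancel₀ _ hZ.ne']
  have hY : tanh η * tiltMass ρ x y = sinh y * cosh x + ρ * (cosh y * sinh x) := by
    rw [hη, tanh_add_channelOdds hρ, tiltMass_comm ρ y x, div_mul_cancel₀ _ hZ.ne']
  set a := (1 - tanh θ) / 2 with ha
  set b := (1 - tanh η) / 2 with hb
  -- The tilted law's mass at `(1, 1)`: letter `1` carries `σ = -1`.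
  set p := (1 + ρ) / 4 * (exp (-x - y) / tiltMass ρ x y) with hp
  have e11 : p * tiltMass ρ x y = (1 + ρ) / 4 * exp (-x - y) := by
    rw [hp]; field_simp
  have e2 : exp (x - y) = (cosh x + sinh x) * (cosh y - sinh y) := by
    rw [cosh_add_sinh, cosh_sub_sinh, ← exp_add, sub_eq_add_neg]
  have e3 : exp (-x + y) = (cosh x - sinh x) * (cosh y + sinh y) := by
    rw [cosh_add_sinh, cosh_sub_sinh, ← exp_add]
  have e4 : exp (-x - y) = (cosh x - sinh x) * (cosh y - sinh y) := by
    rw [cosh_sub_sinh, cosh_sub_sinh, ← exp_add, sub_eq_add_neg]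
  have hN : tiltMass ρ x y = cosh x * cosh y + ρ * (sinh x * sinh y) := rfl
  have q10 : a - p = (1 - ρ) / 4 * (exp (-x + y) / tiltMass ρ x y) := by
    rw [mul_div_assoc', eq_div_iff hZ.ne', sub_mul, e11, e3, e4, ha]
    linear_combination (-1 / 2) * hX + 1 / 2 * hN
  have q01 : b - p = (1 - ρ) / 4 * (exp (x - y) / tiltMass ρ x y) := by
    rw [mul_div_assoc', eq_div_iff hZ.ne', sub_mul, e11, e2, e4, hb]
    linear_combination (-1 / 2) * hY + 1 / 2 * hN
  have q00 : 1 + p - a - b = (1 + ρ) / 4 * (exp (x + y) / tiltMass ρ x y) := by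
    rw [mul_div_assoc', eq_div_iff hZ.ne', show 1 + p - a - b = 1 - p - (a - p) - (b - p) by ring,
      q10, q01]
    have : (1 - p - (1 - ρ) / 4 * (exp (-x + y) / tiltMass ρ x y)
        - (1 - ρ) / 4 * (exp (x - y) / tiltMass ρ x y)) * tiltMass ρ x y =
        tiltMass ρ x y - p * tiltMass ρ x y - (1 - ρ) / 4 * exp (-x + y)
          - (1 - ρ) / 4 * exp (x - y) := by
      field_simp
    rw [this, e11, tiltMass_eq_exp]
    ring
  have hmem : p ∈ Icc (max 0 (a + b - 1)) (min a b) := by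
    have c0 : 0 < p := by positivity
    have c1 : 0 < a - p := by rw [q10]; positivity
    have c2 : 0 < b - p := by rw [q01]; positivity
    have c3 : 0 < 1 + p - a - b := by rw [q00]; positivity
    exact ⟨max_le c0.le (by linarith), le_min (by linarith) (by linarith)⟩
  have hlog {P h : ℝ} (hP : 0 < P) :
      log (P * (exp h / tiltMass ρ x y) / P) = h - log (tiltMass ρ x y) := by
    rw [mul_div_cancel_left₀ _ hP.ne', log_div (exp_pos _).ne' hZ.ne', log_exp]
  have hval : couplingDiv ρ a b p * log 2 =
      x * tanh θ + y * tanh η - log (tiltMass ρ x y) := by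
    have l00 : log ((1 + p - a - b) / ((1 + ρ) / 4)) = x + y - log (tiltMass ρ x y) := by
      rw [q00, hlog hP]
    have l01 : log ((b - p) / ((1 - ρ) / 4)) = x - y - log (tiltMass ρ x y) := by
      rw [q01, hlog hM]
    have l10 : log ((a - p) / ((1 - ρ) / 4)) = -x + y - log (tiltMass ρ x y) := by
      rw [q10, hlog hM]
    have l11 : log (p / ((1 + ρ) / 4)) = -x - y - log (tiltMass ρ x y) := by
      rw [hp, hlog hP]
    rw [couplingDiv_mul_log_two, l00, l01, l10, l11, ha, hb]
    ring
  rw [← hval]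
  exact mul_le_mul_of_nonneg_right
    (minDiv_le hρ (one_sub_tanh_mem hθ0) (one_sub_tanh_mem hη0) hmem) hl2.le

/-- The value of `φ` on the tilted laws with deterministic first coordinate. -/
theorem phi_one_le {ρ y η : ℝ} (hρ : ρ ∈ Ioo (0 : ℝ) 1) (hη : η = y + artanh ρ) (hη0 : 0 ≤ η) :
    phi ρ 1 (divOfOdds η) * log 2 ≤
      log 2 + y * tanh η - log (cosh y + ρ * sinh y) := by
  have hl2 : 0 < log 2 := log_pos one_lt_two
  have hP : 1 + ρ ≠ 0 := by linarith [hρ.1]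
  have hM : 1 - ρ ≠ 0 := by linarith [hρ.2]
  rw [phi, D2inv_divOfOdds hη0, D2inv_one]
  have hb := one_sub_tanh_mem hη0
  -- With `X = 0` almost surely, `p = 0` is the only coupling.
  have hmem : (0 : ℝ) ∈ Icc (max 0 (0 + (1 - tanh η) / 2 - 1)) (min 0 ((1 - tanh η) / 2)) :=
    ⟨max_le le_rfl (by linarith [hb.2]), le_min le_rfl hb.1⟩
  refine (mul_le_mul_of_nonneg_right (minDiv_le hρ (by norm_num) hb hmem) hl2.le).trans_eq ?_
  have hr1 : artanh ρ = 1 / 2 * (log (1 + ρ) - log (1 - ρ)) := by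
    rw [artanh_eq_half_log ⟨by linarith [hρ.1], hρ.2.le⟩, log_div hP hM]
  have hr2 : log (cosh (artanh ρ)) = -(1 / 2 * (log (1 + ρ) + log (1 - ρ))) := by
    rw [cosh_artanh ⟨by linarith [hρ.1], hρ.2⟩, one_div, log_inv, log_sqrt (by nlinarith [hρ.1, hρ.2]),
      show 1 - ρ ^ 2 = (1 + ρ) * (1 - ρ) by ring, log_mul hP hM]
    ring
  have l4 : log 4 = 2 * log 2 := by
    rw [show (4 : ℝ) = 2 ^ 2 by norm_num, log_pow]; norm_num
  have n1 : (1 + tanh η) / 2 ≠ 0 := by linarith [neg_one_lt_tanh η]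
  have n2 : (1 - tanh η) / 2 ≠ 0 := by linarith [tanh_lt_one η]
  rw [couplingDiv_mul_log_two, show 1 + 0 - 0 - (1 - tanh η) / 2 = (1 + tanh η) / 2 by ring,
    sub_zero, sub_zero, cosh_add_mul_sinh hρ, ← hη, log_div (cosh_pos _).ne' (cosh_pos _).ne', hr2,
    log_div n1 (by positivity), log_div n2 (by simpa using hM), log_div hP four_ne_zero,
    log_div hM four_ne_zero, log_one_add_tanh, log_one_sub_tanh, l4]
  have hy : y = η - 1 / 2 * (log (1 + ρ) - log (1 - ρ)) := by linarith
  rw [hy]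
  ring

theorem phi_one_one_le {ρ : ℝ} (hρ : ρ ∈ Ioo (0 : ℝ) 1) :
    phi ρ 1 1 * log 2 ≤ 2 * log 2 - log (1 + ρ) := by
  have hl2 : 0 < log 2 := log_pos one_lt_two
  have hP : 1 + ρ ≠ 0 := by linarith [hρ.1]
  rw [phi, D2inv_one]
  have hmem : (0 : ℝ) ∈ Icc (max 0 (0 + 0 - 1)) (min (0 : ℝ) 0) := by norm_num
  refine (mul_le_mul_of_nonneg_right (minDiv_le hρ (by norm_num) (by norm_num) hmem) hl2.le).trans_eq
    ?_
  have l4 : log 4 = 2 * log 2 := by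
    rw [show (4 : ℝ) = 2 ^ 2 by norm_num, log_pow]; norm_num
  rw [couplingDiv_mul_log_two]
  simp only [add_zero, sub_zero, zero_mul, one_mul]
  rw [one_div_div, log_div four_ne_zero hP, l4]

/-! ### Support at every point of the square -/

/-- `φ` has an affine minorant with nonnegative slopes whose value at `(α, β)` dominates `φ` at
some point of `[α, 1] × [β, 1]`. -/
def HasSupport (ρ α β : ℝ) : Prop :=
  ∃ l m c : ℝ, 0 ≤ l ∧ 0 ≤ m ∧
    (∀ s ∈ Icc (0 : ℝ) 1, ∀ t ∈ Icc (0 : ℝ) 1, c + l * s + m * t ≤ phi ρ s t) ∧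
    ∃ s ∈ Icc α 1, ∃ t ∈ Icc β 1, phi ρ s t ≤ c + l * α + m * β

theorem HasSupport.symm {ρ α β : ℝ} (h : HasSupport ρ α β) : HasSupport ρ β α := by
  obtain ⟨l, m, c, hl, hm, hlow, s, hs, t, ht, hst⟩ := h
  refine ⟨m, l, c, hm, hl, fun s hs t ht => ?_, t, ht, s, hs, ?_⟩
  · rw [phi_comm]; linarith [hlow t ht s hs]
  · rw [phi_comm]; linarith

theorem HasSupport.of_bound {ρ l m K α β s' t' : ℝ} (hρ : ρ ∈ Ioo (0 : ℝ) 1) (hl : 0 ≤ l)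
    (hm : 0 ≤ m)
    (hK : ∀ θ η : ℝ, 0 ≤ θ → 0 ≤ η →
      log (tiltMass ρ (l * θ) (m * η)) - l * log (cosh θ) - m * log (cosh η) ≤ K)
    (hs : s' ∈ Icc α 1) (ht : t' ∈ Icc β 1)
    (hphi : phi ρ s' t' * log 2 ≤ l * (α * log 2) + m * (β * log 2) - K) :
    HasSupport ρ α β := by
  have hl2 : 0 < log 2 := log_pos one_lt_two
  refine ⟨l, m, -(K / log 2), hl, hm, fun s hs t ht => ?_, s', hs, t', ht, ?_⟩
  · linarith [affine_le_phi hρ hl hm hK hs ht]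
  · rw [← mul_le_mul_iff_left₀ hl2]
    have : K / log 2 * log 2 = K := div_mul_cancel₀ _ hl2.ne'
    linarith

theorem log_tiltMass_one_zero_le (ρ θ η : ℝ) :
    log (tiltMass ρ (1 * θ) (0 * η)) - 1 * log (cosh θ) - 0 * log (cosh η) ≤ 0 := by
  simp [tiltMass]

theorem hasSupport_one_one {ρ : ℝ} (hρ : ρ ∈ Ioo (0 : ℝ) 1) : HasSupport ρ 1 1 :=
  .of_bound hρ zero_le_one zero_le_one (fun θ η _ _ => log_tiltMass_one_one_le hρ θ η)
    (right_mem_Icc.2 le_rfl) (right_mem_Icc.2 le_rfl) (by linarith [phi_one_one_le hρ])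

/-- A deterministic input gives the output half log-odds `artanh ρ` at no extra cost. Below that
level slopes `(1, 0)` work; above it the excess `η - artanh ρ` is the tilt on `σ_Y`. -/
theorem hasSupport_one_left {ρ η : ℝ} (hρ : ρ ∈ Ioo (0 : ℝ) 1) (hη : 0 ≤ η) :
    HasSupport ρ 1 (divOfOdds η) := by
  have hr : 0 < artanh ρ := artanh_pos hρ
  rcases le_total η (artanh ρ) with h | h
  · refine .of_bound hρ zero_le_one le_rfl (fun θ η _ _ => log_tiltMass_one_zero_le ρ θ η)
      (right_mem_Icc.2 le_rfl) ⟨divOfOdds_le hη h, (divOfOdds_mem hr.le).2⟩ ?_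
    have := phi_one_le hρ (zero_add (artanh ρ)).symm hr.le
    simp only [zero_mul, cosh_zero, sinh_zero, mul_zero, add_zero, log_one, sub_zero] at this
    linarith
  · have hy : η = η - artanh ρ + artanh ρ := by ring
    have hy0 : 0 ≤ η - artanh ρ := by linarith
    have hm : (η - artanh ρ) / η * η = η - artanh ρ := div_mul_cancel₀ _ (by linarith)
    refine .of_bound hρ zero_le_one (div_nonneg hy0 hη)
      (fun s t _ ht => log_tiltMass_le_of_deterministic hρ hy0 hy ht)
      (right_mem_Icc.2 le_rfl) ⟨le_rfl, (divOfOdds_mem hη).2⟩ ?_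
    rw [divOfOdds_mul_log_two, mul_sub ((η - artanh ρ) / η), ← mul_assoc _ η, hm]
    linarith [phi_one_le hρ hy hη]

/-- Tilting only `σ_X` costs `divOfOdds θ` and already biases `σ_Y` to `channelOdds ρ θ ≥ η`, so the
second constraint is free. -/
theorem hasSupport_of_le_channelOdds {ρ θ η : ℝ} (hρ : ρ ∈ Ioo (0 : ℝ) 1) (hθ : 0 ≤ θ)
    (hη : 0 ≤ η) (h : η ≤ channelOdds ρ θ) : HasSupport ρ (divOfOdds θ) (divOfOdds η) := by
  have hA := channelOdds_nonneg hρ hθ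
  refine .of_bound hρ zero_le_one le_rfl (fun θ η _ _ => log_tiltMass_one_zero_le ρ θ η)
    ⟨le_rfl, (divOfOdds_mem hθ).2⟩ ⟨divOfOdds_le hη h, (divOfOdds_mem hA).2⟩ ?_
  have := phi_le_of_tilt hρ (x := θ) (y := 0) (by simp) (zero_add _).symm hθ hA
  rw [divOfOdds_mul_log_two]
  simp only [tiltMass, cosh_zero, sinh_zero, mul_one, mul_zero, add_zero, zero_mul] at this
  linarith

/-- The tilt parameters realizing given marginal half log-odds. -/
theorem exists_tilt_of_channelOdds_lt {ρ θ η : ℝ} (hρ : ρ ∈ Ioo (0 : ℝ) 1) (hθ : 0 ≤ θ)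
    (h1 : channelOdds ρ θ < η) (h2 : channelOdds ρ η < θ) :
    ∃ x y, 0 < x ∧ 0 < y ∧ θ = x + channelOdds ρ y ∧ η = y + channelOdds ρ x := by
  have hc : Continuous (channelOdds ρ) :=
    continuous_iff_continuousAt.2 fun v => (hasDerivAt_channelOdds hρ v).continuousAt
  have hcont : Continuous fun x => x + channelOdds ρ (η - channelOdds ρ x) := by fun_prop
  -- At `x = 0` the map equals `channelOdds ρ η < θ`; at `x = θ` it exceeds `θ` because `channelOdds
  -- ρ θ < η`.
  obtain ⟨x, hx, hxθ⟩ := intermediate_value_Ioo hθ hcont.continuousOn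
    (show θ ∈ Ioo _ _ from ⟨by simpa using h2, by
      simpa using channelOdds_pos hρ (sub_pos.2 h1)⟩)
  refine ⟨x, η - channelOdds ρ x, hx.1, ?_, hxθ.symm, by ring⟩
  linarith [monotone_channelOdds hρ hx.2.le]

/-- Slopes `x / θ` and `y / η` make `(θ, η)` stationary, and the minorant touches `φ` at `(α, β)`
itself. -/
theorem hasSupport_of_channelOdds_lt {ρ θ η : ℝ} (hρ : ρ ∈ Ioo (0 : ℝ) 1) (hθ : 0 ≤ θ)
    (hη : 0 ≤ η) (h1 : channelOdds ρ θ < η) (h2 : channelOdds ρ η < θ) :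
    HasSupport ρ (divOfOdds θ) (divOfOdds η) := by
  obtain ⟨x, y, hx, hy, hxθ, hyη⟩ := exists_tilt_of_channelOdds_lt hρ hθ h1 h2
  have hl : x / θ * θ = x := div_mul_cancel₀ _ ((channelOdds_nonneg hρ hη).trans_lt h2).ne'
  have hm : y / η * η = y := div_mul_cancel₀ _ ((channelOdds_nonneg hρ hθ).trans_lt h1).ne'
  refine .of_bound hρ (div_nonneg hx.le hθ) (div_nonneg hy.le hη)
    (fun s t hs ht => log_tiltMass_le_of_stationary hρ hx hy hxθ hyη hs ht)
    ⟨le_rfl, (divOfOdds_mem hθ).2⟩ ⟨le_rfl, (divOfOdds_mem hη).2⟩ ?_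
  rw [divOfOdds_mul_log_two, divOfOdds_mul_log_two, mul_sub (x / θ), mul_sub (y / η),
    ← mul_assoc _ θ, ← mul_assoc _ η, hl, hm]
  linarith [phi_le_of_tilt hρ hxθ hyη hθ hη]

theorem hasSupport {ρ α β : ℝ} (hρ : ρ ∈ Ioo (0 : ℝ) 1) (hα : α ∈ Icc (0 : ℝ) 1)
    (hβ : β ∈ Icc (0 : ℝ) 1) : HasSupport ρ α β := by
  rcases hα.2.lt_or_eq with hα1 | rfl
  · obtain ⟨θ, hθ, rfl⟩ := exists_divOfOdds ⟨hα.1, hα1⟩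
    rcases hβ.2.lt_or_eq with hβ1 | rfl
    · obtain ⟨η, hη, rfl⟩ := exists_divOfOdds ⟨hβ.1, hβ1⟩
      rcases le_or_gt η (channelOdds ρ θ) with h1 | h1
      · exact hasSupport_of_le_channelOdds hρ hθ hη h1
      rcases le_or_gt θ (channelOdds ρ η) with h2 | h2
      · exact (hasSupport_of_le_channelOdds hρ hη hθ h2).symm
      exact hasSupport_of_channelOdds_lt hρ hθ hη h1 h2
    · exact (hasSupport_one_left hρ hθ).symm
  · rcases hβ.2.lt_or_eq with hβ1 | rfl
    · obtain ⟨η, hη, rfl⟩ := exists_divOfOdds ⟨hβ.1, hβ1⟩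
      exact hasSupport_one_left hρ hη
    · exact hasSupport_one_one hρ

/-! ### Attainment, convexity and the convex envelope -/

/-- Nonnegative slopes keep the minorant above its value at `(α, β)` on the whole upper quadrant, so
the point supplied by `HasSupport` is a minimizer. -/
theorem phiTilde_isLeast {ρ α β : ℝ} (hρ : ρ ∈ Ioo (0 : ℝ) 1) (hα : α ∈ Icc (0 : ℝ) 1)
    (hβ : β ∈ Icc (0 : ℝ) 1) : IsLeast (phiValues ρ α β) (phiTilde ρ α β) := by
  obtain ⟨l, m, c, hl, hm, hlow, s, hs, t, ht, hst⟩ := hasSupport hρ hα hβ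
  have h : IsLeast (phiValues ρ α β) (phi ρ s t) := by
    refine ⟨⟨s, hs, t, ht, rfl⟩, ?_⟩
    rintro _ ⟨u, hu, v, hv, rfl⟩
    have h1 := hlow u ⟨hα.1.trans hu.1, hu.2⟩ v ⟨hβ.1.trans hv.1, hv.2⟩
    have h2 := mul_le_mul_of_nonneg_left hu.1 hl
    have h3 := mul_le_mul_of_nonneg_left hv.1 hm
    linarith
  rw [phiTilde, h.csInf_eq]
  exact h

/-- At every point of the square, `φ̃` has a supporting affine function. -/
theorem exists_affine_support_phiTilde {ρ α β : ℝ} (hρ : ρ ∈ Ioo (0 : ℝ) 1)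
    (hα : α ∈ Icc (0 : ℝ) 1) (hβ : β ∈ Icc (0 : ℝ) 1) :
    ∃ l m c : ℝ, phiTilde ρ α β ≤ c + l * α + m * β ∧
      ∀ s ∈ Icc (0 : ℝ) 1, ∀ t ∈ Icc (0 : ℝ) 1, c + l * s + m * t ≤ phiTilde ρ s t := by
  obtain ⟨l, m, c, hl, hm, hlow, s, hs, t, ht, hst⟩ := hasSupport hρ hα hβ
  refine ⟨l, m, c, ((phiTilde_isLeast hρ hα hβ).2 ⟨s, hs, t, ht, rfl⟩).trans hst,
    fun s hs t ht => ?_⟩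
  obtain ⟨u, hu, v, hv, huv⟩ := (phiTilde_isLeast hρ hs ht).1
  have h1 := hlow u ⟨hs.1.trans hu.1, hu.2⟩ v ⟨ht.1.trans hv.1, hv.2⟩
  have h2 := mul_le_mul_of_nonneg_left hu.1 hl
  have h3 := mul_le_mul_of_nonneg_left hv.1 hm
  rw [huv]
  linarith

theorem convexOn_phiTilde {ρ : ℝ} (hρ : ρ ∈ Ioo (0 : ℝ) 1) :
    ConvexOn ℝ unitSquare fun x => phiTilde ρ x.1 x.2 := by
  have hconv : Convex ℝ unitSquare := (convex_Icc 0 1).prod (convex_Icc 0 1)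
  refine ⟨hconv, fun x hx y hy a b ha hb hab => ?_⟩
  obtain ⟨h1, h2⟩ := hconv hx hy ha hb hab
  obtain ⟨l, m, c, htop, hlow⟩ := exists_affine_support_phiTilde hρ h1 h2
  have hx' := mul_le_mul_of_nonneg_left (hlow x.1 hx.1 x.2 hx.2) ha
  have hy' := mul_le_mul_of_nonneg_left (hlow y.1 hy.1 y.2 hy.2) hb
  refine htop.trans ?_
  simp only [Prod.fst_add, Prod.snd_add, Prod.smul_fst, Prod.smul_snd, smul_eq_mul]
  have hc : c = a * c + b * c := by rw [← add_mul, hab, one_mul]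
  linarith

theorem lowerConvexEnvelope_eqOn {S : Set (ℝ × ℝ)} {f : ℝ × ℝ → ℝ} (hf : ConvexOn ℝ S f) :
    EqOn (lowerConvexEnvelope S f) f S := by
  intro x hx
  refine IsGreatest.csSup_eq ⟨⟨f, hf, fun _ _ => le_rfl, rfl⟩, ?_⟩
  rintro _ ⟨g, -, hg, rfl⟩
  exact hg x hx

end DSBS

end

theorem theorem1 (ρ : ℝ) (hρ : ρ ∈ Set.Ioo (0 : ℝ) 1) :
    (∀ α ∈ Set.Icc (0 : ℝ) 1, ∀ β ∈ Set.Icc (0 : ℝ) 1,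
      IsLeast (DSBS.phiValues ρ α β) (DSBS.phiTilde ρ α β)) ∧
    ConvexOn ℝ DSBS.unitSquare (fun x => DSBS.phiTilde ρ x.1 x.2) ∧
    Set.EqOn (DSBS.thetaLower ρ) (fun x => DSBS.phiTilde ρ x.1 x.2) DSBS.unitSquare :=
  ⟨fun _ hα _ hβ => DSBS.phiTilde_isLeast hρ hα hβ, DSBS.convexOn_phiTilde hρ,
    DSBS.lowerConvexEnvelope_eqOn (DSBS.convexOn_phiTilde hρ)⟩
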